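/- Setting. A causal diagram is a finite directed acyclic graph $G$ whose nodes are random variables $X_i$ given by nonparametric structural equations $X_i=f_i(\mathrm{pa}_i,\varepsilon_i)$, where $\mathrm{pa}_i$ are the parents of $X_i$ in $G$ and the errors $\varepsilon_i$ are mutually independent. For two distinct nodes $A$ (the exposure) and $Y$ (the outcome), the potential outcome $Y_a$ is obtained by recursive substitution after replacing the equation of $A$ by $A=a$. The model is faithful if, for all disjoint sets of nodes $S,T,R$, the independence $S\perp\!\!\!\perp T\mid R$ holds only when $S$ and $T$ are d-separated given $R$ in $G$. The pre-exposure covariates form a set of nodes other than $A$ and $Y$ that contains no descendant of $A$ and contains every ancestor of $A$ (so $Y$ is not an ancestor of $A$). Association-based definition: a pre-exposure covariate $C$ is a confounder for the effect of $A$ on $Y$ if there is a (possibly empty) set $X$ of pre-exposure covariates such that $C\not\perp\!\!\!\perp A\mid X$ and $C\not\perp\!\!\!\perp Y\mid (A,X)$. Proposition. (i) For every causal diagram, every faithful model on it, and every such $A$, $Y$ and set of pre-exposure covariates: if $S$ is the set of all confounders in the above sense, then $Y_a\perp\!\!\!\perp A\mid S$ for every value $a$ of $A$. (ii) Let $G$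 be the M-bias diagram with nodes $C_1,C_2,C_3,A,Y$, edges $C_1\to A$, $C_1\to C_3$, $C_2\to C_3$, $C_2\to Y$, $A\to Y$, and pre-exposure covariates $C_1,C_2,C_3$. There is a faithful model on $G$, with all variables binary and all joint values having positive probability, in which both of the following fail. (2A) For every confounder $C$ in the above sense there is a set $X$ of pre-exposure covariates with $Y_a\perp\!\!\!\perp A\mid (X,C)$ for every $a$, but not $Y_a\perp\!\!\!\perp A\mid X$ for every $a$. (2B) For every confounder $C$ in the above sense there is a set $X$ of pre-exposure covariates with $$\Big|\sum_{x,c}\{E(Y\mid A=1,x,c)-E(Y\mid A=0,x,c)\}\operatorname{pr}(x,c)-\{E(Y_1)-E(Y_0)\}\Big|<\Big|\sum_{x}\{E(Y\mid A=1,x)-E(Y\mid A=0,x)\}\operatorname{pr}(x)-\{E(Y_1)-E(Y_0)\}\Big|.$$ -/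

import Mathlib

open MeasureTheory ProbabilityTheory

universe u v w w'

/-- A directed acyclic graph: no node has a nonempty sequence of directed edges back to itself. -/
structure DAG (V : Type u) extends Digraph V where
  acyclic : ∀ i, ¬ Relation.TransGen Adj i i

namespace DAG

variable {V : Type u} (G : DAG V)

/-- `G.Ancestor i j`: there is a directed path with at least one edge from `i` to `j`,
i.e. `i` is an ancestor of `j` and `j` is a descendant of `i`. -/
def Ancestor (i j : V) : Prop := Relation.TransGen G.Adj i j

/-- `G.IsPath i j p`: the list `p` is a path from `i` to `j`, i.e. a sequence of distinct nodes,
consecutive ones being joined by an edge regardless of its direction. -/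
def IsPath (i j : V) (p : List V) : Prop :=
  p.Nodup ∧ p.head? = some i ∧ p.getLast? = some j ∧
    p.IsChain (fun k l => G.Adj k l ∨ G.Adj l k)

/-- `m` is a collider on the path `p`: both the preceding and the subsequent node on `p` have an
edge into `m`. -/
def IsCollider (p : List V) (m : V) : Prop :=
  ∃ l r, [l, m, r] <:+: p ∧ G.Adj l m ∧ G.Adj r m

/-- The path `p` is blocked by `R`: a node of `R` on `p` is not a collider, or neither some
collider on `p` nor any of its descendants is in `R`. -/
def Blocked (p : List V) (R : Set V) : Prop :=
  (∃ m ∈ p, m ∈ R ∧ ¬ G.IsCollider p m) ∨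
    (∃ m, G.IsCollider p m ∧ m ∉ R ∧ ∀ d, G.Ancestor m d → d ∉ R)

/-- `S` and `T` are d-separated given `R`. -/
def DSep (S T R : Set V) : Prop :=
  ∀ i ∈ S, ∀ j ∈ T, ∀ p, G.IsPath i j p → G.Blocked p R

/-- `Pre` can serve as the set of pre-exposure covariates for the exposure `A` and the outcome `Y`:
it consists of nodes other than `A` and `Y` that are not descendants of `A`, and, as causes precede
their effects, it contains all ancestors of `A`. (So `Y` is not an ancestor of `A`.) -/
structure IsPreExposure (A Y : V) (Pre : Set V) : Prop where
  exposure_notMem : A ∉ Pre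
  outcome_notMem : Y ∉ Pre
  nondescendant : ∀ C ∈ Pre, ¬ G.Ancestor A C
  ancestor_mem : ∀ C, G.Ancestor C A → C ∈ Pre

theorem wellFounded [Finite V] : WellFounded G.Adj := by
  have : Std.Irrefl (Relation.TransGen G.Adj) := ⟨G.acyclic⟩
  have h : WellFounded (Relation.TransGen G.Adj) := Finite.wellFounded_of_trans_of_irrefl _
  exact Subrelation.wf (fun h => Relation.TransGen.single h) h

end DAG

set_option linter.checkUnivs false in
/-- A causal model with causal diagram `G`: a system of nonparametric structural equations
`X i = f i (pa i, ε i)`, where `pa i` are the values of the parents of `i` and the `ε i` are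
mutually independent random variables on a probability space. Variable `i` takes values
in `val i`. -/
structure CausalModel {V : Type u} (G : DAG V) (val : V → Type v)
    [∀ i, MeasurableSpace (val i)] where
  Ω : Type w
  [measurableSpaceΩ : MeasurableSpace Ω]
  [standardBorelΩ : StandardBorelSpace Ω]
  P : Measure Ω
  [isProbabilityMeasureP : IsProbabilityMeasure P]
  Noise : V → Type w'
  [measurableSpaceNoise : ∀ i, MeasurableSpace (Noise i)]
  ε : ∀ i, Ω → Noise i
  measurable_ε : ∀ i, Measurable (ε i)
  indep_ε : iIndepFun ε P
  f : ∀ i, (∀ j : {j // G.Adj j i}, val j) → Noise i → val i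
  measurable_f : ∀ i, Measurable (Function.uncurry (f i))

namespace CausalModel

attribute [instance] measurableSpaceΩ standardBorelΩ isProbabilityMeasureP measurableSpaceNoise

section

variable {V : Type u} [Finite V] {G : DAG V} {val : V → Type v} [∀ i, MeasurableSpace (val i)]
  (M : CausalModel.{u, v, w, w'} G val)

/-- Recursive substitution. The node `i` is set to `x` if `s i = some x`, and is given by its own
structural equation if `s i = none`. -/
noncomputable def solve (s : ∀ i, Option (val i)) (ω : M.Ω) : ∀ i, val i :=
  G.wellFounded.fix (fun i ih => (s i).getD (M.f i (fun j => ih j.1 j.2) (M.ε i ω)))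

theorem solve_eq (s : ∀ i, Option (val i)) (ω : M.Ω) (i : V) :
    M.solve s ω i = (s i).getD (M.f i (fun j => M.solve s ω j.1) (M.ε i ω)) :=
  G.wellFounded.fix_eq _ i

theorem measurable_solve (s : ∀ i, Option (val i)) (i : V) :
    Measurable (fun ω => M.solve s ω i) := by
  induction i using G.wellFounded.induction with
  | _ i ih =>
    simp only [M.solve_eq s _ i]
    cases s i with
    | some x => exact measurable_const
    | none =>
      exact (M.measurable_f i).comp
        ((measurable_pi_lambda _ fun j => ih j.1 j.2).prodMk (M.measurable_ε i))

/-- The observed variable at node `i`. -/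
noncomputable def obs (i : V) (ω : M.Ω) : val i := M.solve (fun _ => none) ω i

/-- The potential outcome `Y_a`: the value of `Y` if the exposure `A` were set to `a`. -/
noncomputable def potential (A : V) (a : val A) (Y : V) (ω : M.Ω) : val Y :=
  open Classical in M.solve (Function.update (fun _ => none) A (some a)) ω Y

/-- The vector of the observed variables at the nodes of `S`. -/
noncomputable def obsOn (S : Set V) (ω : M.Ω) : ∀ i : S, val i := fun i => M.obs i ω

theorem measurable_obsOn (S : Set V) : Measurable (M.obsOn S) :=
  measurable_pi_lambda _ fun i => M.measurable_solve _ i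

/-- `S ⊥ T | R` for the observed variables at three sets of nodes. -/
def CondIndepNodes (S T R : Set V) : Prop :=
  CondIndepFun (MeasurableSpace.comap (M.obsOn R) inferInstance) (M.measurable_obsOn R).comap_le
    (M.obsOn S) (M.obsOn T) M.P

/-- Faithfulness: conditional independence of disjoint sets of variables holds only when it is
implied by d-separation in the diagram. -/
def Faithful : Prop :=
  ∀ S T R : Set V, Disjoint S T → Disjoint S R → Disjoint T R →
    M.CondIndepNodes S T R → G.DSep S T R

/-- No confounding of the effect of `A` on `Y` conditional on `S`: `Y_a ⊥ A | S` for every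
exposure level `a`. -/
def NoConfounding (A Y : V) (S : Set V) : Prop :=
  ∀ a : val A,
    CondIndepFun (MeasurableSpace.comap (M.obsOn S) inferInstance) (M.measurable_obsOn S).comap_le
      (M.potential A a Y) (M.obs A) M.P

/-- The association-based definition of the confounders for the effect of `A` on `Y`, among the
pre-exposure covariates `Pre`: those `C` which, for some set `X` of pre-exposure covariates, are
associated with `A` given `X` and with `Y` given `(A, X)`. -/
def assocConfounders (Pre : Set V) (A Y : V) : Set V :=
  {C | C ∈ Pre ∧ ∃ X ⊆ Pre,
    ¬ M.CondIndepNodes {C} {A} X ∧ ¬ M.CondIndepNodes {C} {Y} (insert A X)}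

/-- For the set `K` of all confounders according to some definition: every confounder `C` in `K`
helps eliminate bias, i.e. for some set `X` of pre-exposure covariates there is no confounding
conditional on `(X, C)` but there is conditional on `X`. -/
def EachEliminatesBias (Pre : Set V) (A Y : V) (K : Set V) : Prop :=
  ∀ C ∈ K, ∃ X ⊆ Pre, M.NoConfounding A Y (insert C X) ∧ ¬ M.NoConfounding A Y X

end

section

variable {V : Type u} [Fintype V] {G : DAG V} {val : V → Type v} [∀ i, MeasurableSpace (val i)]
  (M : CausalModel.{u, v, w, w'} G val)

/-- `E(Y | A = a, X = x)`, with `y` giving the numerical values of the outcome. -/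
noncomputable def condMean (A Y : V) (y : val Y → ℝ) (a : val A) (X : Set V)
    (x : ∀ i : X, val i) : ℝ :=
  ∫ ω, y (M.obs Y ω) ∂(M.P[|{ω | M.obs A ω = a ∧ M.obsOn X ω = x}])

open Classical in
/-- `∑ₓ {E(Y | A = a₁, x) - E(Y | A = a₀, x)} pr(x)`, for variables with finitely many values. -/
noncomputable def adjustedContrast [∀ i, Fintype (val i)] (A Y : V) (y : val Y → ℝ)
    (a₁ a₀ : val A) (X : Set V) : ℝ :=
  ∑ x : (∀ i : X, val i),
    (M.condMean A Y y a₁ X x - M.condMean A Y y a₀ X x) * M.P.real {ω | M.obsOn X ω = x}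

/-- `E(Y_{a₁}) - E(Y_{a₀})`. -/
noncomputable def causalContrast (A Y : V) (y : val Y → ℝ) (a₁ a₀ : val A) : ℝ :=
  (∫ ω, y (M.potential A a₁ Y ω) ∂M.P) - ∫ ω, y (M.potential A a₀ Y ω) ∂M.P

/-- For the set `K` of all confounders according to some definition: every confounder `C` in `K`
helps reduce bias, i.e. for some set `X` of pre-exposure covariates the bias when adjusting for
`(X, C)` is smaller than the bias when adjusting for `X`. -/
def EachReducesBias [∀ i, Fintype (val i)] (Pre : Set V) (A Y : V) (y : val Y → ℝ)
    (a₁ a₀ : val A) (K : Set V) : Prop :=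
  ∀ C ∈ K, ∃ X ⊆ Pre,
    |M.adjustedContrast A Y y a₁ a₀ (insert C X) - M.causalContrast A Y y a₁ a₀| <
      |M.adjustedContrast A Y y a₁ a₀ X - M.causalContrast A Y y a₁ a₀|

/-- Every joint value of all the observed variables has positive probability. For variables with
finitely many values, all conditional expectations `E(Y | A = a, X = x)` with `Y ∉ X`, `A ∉ X`
are then conditional on events of positive probability. -/
def FullSupport : Prop :=
  ∀ x : ∀ i, val i, 0 < M.P {ω | ∀ i, M.obs i ω = x i}

end

end CausalModel

/-- The nodes of the M-bias diagram. -/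
inductive MNode
  | c1 | c2 | c3 | a | y
  deriving DecidableEq

namespace MNode

instance : Fintype MNode where
  elems := {c1, c2, c3, a, y}
  complete i := by cases i <;> decide

/-- The edges `c1 → a`, `c1 → c3`, `c2 → c3`, `c2 → y` and `a → y`. -/
inductive Edge : MNode → MNode → Prop
  | c1_a : Edge c1 a
  | c1_c3 : Edge c1 c3
  | c2_c3 : Edge c2 c3
  | c2_y : Edge c2 y
  | a_y : Edge a y

/-- A numbering of the nodes along which all edges of the M-bias diagram increase. -/
def rank : MNode → ℕ
  | c1 => 0
  | c2 => 0
  | c3 => 1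
  | a => 1
  | y => 2

theorem rank_lt {i j : MNode} (h : Relation.TransGen Edge i j) : rank i < rank j := by
  have key : ∀ {k l : MNode}, Edge k l → rank k < rank l := by
    intro k l h
    cases h <;> decide
  induction h with
  | single h => exact key h
  | tail _ h ih => exact ih.trans (key h)

end MNode

/-- The M-bias diagram. -/
def mBias : DAG MNode where
  Adj := MNode.Edge
  acyclic := fun _ h => lt_irrefl _ (MNode.rank_lt h)

-- Conditional independence obtained from independent σ-algebras.

section Independence

variable {Ω : Type*} {m₁ m₂ n₁ n₂ mΩ : MeasurableSpace Ω} {μ : Measure Ω} [IsProbabilityMeasure μ]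

-- For (i), delete the edges at `A` and let `H` be the ancestral hull of `Pre` and `Y` in what
-- remains. Let `K` be the set of nodes linked inside `H` to a parent of `A` outside `S`. Both `K`
-- and `H \ K` are closed under parents other than `A`, so they are driven by disjoint sets of
-- errors. If `Y ∉ K`, then `Y_a` depends on the errors of `H \ K` only, while `A` depends on its
-- own error, the errors of `K` and variables in `S`. Each covariate in `S` is a function of the
-- errors of one side, so independence of the two sides survives conditioning on `S`
-- (`noConfounding_of_split`, resting on `condIndep_sup_of_indep`). That `Y ∉ K` is a graph
-- argument. A link from a parent `C ∉ S` to `Y` would give some `X ⊆ Pre \ {C}` and a path from `C`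
-- to `Y` open given `X` (`Linked.exists_not_blocked`). The path avoids `A`, so it is open given
-- `(A, X)` as well. As `C` is adjacent to `A`, faithfulness makes `C` a confounder, a
-- contradiction.
--
-- For (ii), faithfulness alone makes `c3` a confounder. Without `c3` in `X` there is no confounding
-- and hence no bias to remove; with `c3` in `X`, adding it changes nothing. What remains is one
-- explicit faithful model with full support. Its faithfulness reduces to finitely many integer
-- inequalities (`weightTrue_mul_ne`): each open path is matched with a failing product rule for the
-- event that all variables concerned are true.

theorem setIntegral_eq_measureReal_mul_integral_of_indep (hm₁ : m₁ ≤ mΩ) (hm₂ : m₂ ≤ mΩ)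
    (hind : Indep m₁ m₂ μ) {g : Ω → ℝ} (hg : StronglyMeasurable[m₂] g) (hgi : Integrable g μ)
    {s : Set Ω} (hs : MeasurableSet[m₁] s) :
    ∫ ω in s, g ω ∂μ = μ.real s * ∫ ω, g ω ∂μ := by
  rw [← setIntegral_condExp hm₁ hgi hs,
    setIntegral_congr_ae (g := fun _ => ∫ ω, g ω ∂μ) (hm₁ s hs)
      ((condExp_indep_eq hm₂ hm₁ hg hind.symm).mono fun ω h _ => h)]
  simp

theorem generateFrom_inter_eq_sup (m n : MeasurableSpace Ω) :
    m ⊔ n = MeasurableSpace.generateFrom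
      {u | ∃ s t, MeasurableSet[m] s ∧ MeasurableSet[n] t ∧ s ∩ t = u} := by
  apply le_antisymm
  · refine sup_le (fun s hs => ?_) (fun t ht => ?_)
    · exact MeasurableSpace.measurableSet_generateFrom
        ⟨s, Set.univ, hs, MeasurableSet.univ, by simp⟩
    · exact MeasurableSpace.measurableSet_generateFrom
        ⟨Set.univ, t, MeasurableSet.univ, ht, by simp⟩
  · refine MeasurableSpace.generateFrom_le ?_
    rintro _ ⟨s, t, hs, ht, rfl⟩
    exact MeasurableSet.inter ((le_sup_left : m ≤ m ⊔ n) s hs) ((le_sup_right : n ≤ m ⊔ n) t ht)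

theorem isPiSystem_measurableSet_inter (m n : MeasurableSpace Ω) :
    IsPiSystem {u : Set Ω | ∃ s t, MeasurableSet[m] s ∧ MeasurableSet[n] t ∧ s ∩ t = u} := by
  rintro _ ⟨s, t, hs, ht, rfl⟩ _ ⟨s', t', hs', ht', rfl⟩ _
  exact ⟨s ∩ s', t ∩ t', hs.inter hs', ht.inter ht', Set.inter_inter_inter_comm _ _ _ _⟩

/-- Enlarging the conditioning σ-algebra by an independent one does not change the conditional
expectation. -/
theorem condExp_sup_eq_of_indep (hm₁ : m₁ ≤ mΩ) (hm₂ : m₂ ≤ mΩ) (hind : Indep m₁ m₂ μ)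
    (hn₂ : n₂ ≤ m₂) {f : Ω → ℝ} (hf : StronglyMeasurable[m₂] f) (hfi : Integrable f μ) :
    μ[f | n₂] =ᵐ[μ] μ[f | m₁ ⊔ n₂] := by
  have hn : n₂ ≤ mΩ := hn₂.trans hm₂
  have hsup : m₁ ⊔ n₂ ≤ mΩ := sup_le hm₁ hn
  have hgi : Integrable (μ[f | n₂]) μ := integrable_condExp
  have hg : StronglyMeasurable[n₂] (μ[f | n₂]) := stronglyMeasurable_condExp
  refine ae_eq_condExp_of_forall_setIntegral_eq hsup hfi (fun _ _ _ => hgi.integrableOn) ?_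
    (hg.mono (le_sup_right : n₂ ≤ m₁ ⊔ n₂)).aestronglyMeasurable
  intro u hu _
  induction u, hu using MeasurableSpace.induction_on_inter (generateFrom_inter_eq_sup m₁ n₂)
    (isPiSystem_measurableSet_inter m₁ n₂) with
  | empty => simp
  | basic u hu =>
    obtain ⟨s, t, hs, ht, rfl⟩ := hu
    -- The factor `t` is absorbed into the integrand, which stays `m₂`-measurable, so only `s` has
    -- to be split off by independence.
    have key : ∀ h : Ω → ℝ, StronglyMeasurable[m₂] h → Integrable h μ →
        ∫ ω in s ∩ t, h ω ∂μ = μ.real s * ∫ ω in t, h ω ∂μ := by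
      intro h hh hi
      rw [← setIntegral_indicator (hn t ht), ← integral_indicator (hn t ht)]
      exact setIntegral_eq_measureReal_mul_integral_of_indep hm₁ hm₂ hind
        (hh.indicator (hn₂ t ht)) (hi.indicator (hn t ht)) hs
    rw [key _ (hg.mono hn₂) hgi, key _ hf hfi, setIntegral_condExp hn hfi ht]
  | compl u hu ih =>
    have h₁ := integral_add_compl (hsup u hu) hgi
    have h₂ := integral_add_compl (hsup u hu) hfi
    have h₃ := integral_condExp (f := f) (μ := μ) hn
    simp only [measure_lt_top, forall_const] at ih
    linarith
  | iUnion u hd hu ih =>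
    rw [integral_iUnion (fun i => hsup _ (hu i)) hd hgi.integrableOn,
      integral_iUnion (fun i => hsup _ (hu i)) hd hfi.integrableOn]
    exact tsum_congr fun i => ih i (measure_lt_top _ _)

/-- If `m₁` and `m₂` are independent, then they are conditionally independent given any
`n₁ ⊔ n₂` with `n₁ ≤ m₁` and `n₂ ≤ m₂`, even after adding `n₂` to `m₁`. -/
theorem condIndep_sup_of_indep [StandardBorelSpace Ω] (hm₁ : m₁ ≤ mΩ) (hm₂ : m₂ ≤ mΩ)
    (hind : Indep m₁ m₂ μ) (hn₁ : n₁ ≤ m₁) (hn₂ : n₂ ≤ m₂) (hn : n₁ ⊔ n₂ ≤ mΩ) :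
    CondIndep (n₁ ⊔ n₂) m₂ (m₁ ⊔ n₂) hn μ := by
  have hn₂' : n₂ ≤ mΩ := hn₂.trans hm₂
  have hsup : m₁ ⊔ n₂ ≤ mΩ := sup_le hm₁ hn₂'
  rw [condIndep_iff _ _ _ hn hm₂ hsup]
  intro B A hB hA
  have hBf : StronglyMeasurable[m₂] (B.indicator fun _ => (1 : ℝ)) :=
    (@stronglyMeasurable_const _ _ m₂ _ _).indicator hB
  have hBi : Integrable (B.indicator fun _ => (1 : ℝ)) μ :=
    (integrable_const _).indicator (hm₂ B hB)
  have hAi : Integrable (A.indicator fun _ => (1 : ℝ)) μ :=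
    (integrable_const _).indicator (hsup A hA)
  have hle : n₁ ⊔ n₂ ≤ m₁ ⊔ n₂ := sup_le_sup_right hn₁ _
  -- One `n₂`-measurable function serves as the conditional probability of `B` given both the small
  -- and the large σ-algebra; the tower property then gives the product rule.
  set b := μ[B.indicator fun _ => (1 : ℝ) | n₂] with hb
  have hb₁ : b =ᵐ[μ] μ[B.indicator fun _ => (1 : ℝ) | m₁ ⊔ n₂] :=
    condExp_sup_eq_of_indep hm₁ hm₂ hind hn₂ hBf hBi
  have hb₂ : b =ᵐ[μ] μ[B.indicator fun _ => (1 : ℝ) | n₁ ⊔ n₂] :=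
    condExp_sup_eq_of_indep (hn₁.trans hm₁) hm₂ (indep_of_indep_of_le_left hind hn₁) hn₂ hBf hBi
  have hbm : StronglyMeasurable[n₂] b := stronglyMeasurable_condExp
  have hprod : ((B ∩ A).indicator fun _ => (1 : ℝ)) =
      (A.indicator fun _ => (1 : ℝ)) * B.indicator fun _ => (1 : ℝ) := by
    rw [Set.inter_comm]; exact Set.inter_indicator_one (M₀ := ℝ)
  have hAm : StronglyMeasurable[m₁ ⊔ n₂] (A.indicator fun _ => (1 : ℝ)) :=
    (@stronglyMeasurable_const _ _ (m₁ ⊔ n₂) _ _).indicator hA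
  have hABi : Integrable ((A.indicator fun _ => (1 : ℝ)) * B.indicator fun _ => (1 : ℝ)) μ := by
    rw [← hprod]
    exact (integrable_const _).indicator ((hm₂ B hB).inter (hsup A hA))
  have h₁ : μ[(B ∩ A).indicator fun _ => (1 : ℝ) | m₁ ⊔ n₂] =ᵐ[μ]
      (A.indicator fun _ => (1 : ℝ)) * b := by
    rw [hprod]
    exact (condExp_mul_of_stronglyMeasurable_left hAm hABi hBi).trans
      ((Filter.EventuallyEq.refl _ _).mul hb₁.symm)
  have hAbi : Integrable ((A.indicator fun _ => (1 : ℝ)) * b) μ :=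
    integrable_condExp.congr h₁
  calc μ[(B ∩ A).indicator fun _ => (1 : ℝ) | n₁ ⊔ n₂]
      =ᵐ[μ] μ[μ[(B ∩ A).indicator fun _ => (1 : ℝ) | m₁ ⊔ n₂] | n₁ ⊔ n₂] :=
        (condExp_condExp_of_le hle hsup).symm
    _ =ᵐ[μ] μ[(A.indicator fun _ => (1 : ℝ)) * b | n₁ ⊔ n₂] := condExp_congr_ae h₁
    _ =ᵐ[μ] μ[A.indicator fun _ => (1 : ℝ) | n₁ ⊔ n₂] * b :=
        condExp_mul_of_stronglyMeasurable_right (hbm.mono le_sup_right) hAbi hAi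
    _ =ᵐ[μ] μ[B.indicator fun _ => (1 : ℝ) | n₁ ⊔ n₂] *
          μ[A.indicator fun _ => (1 : ℝ) | n₁ ⊔ n₂] := by
        rw [mul_comm]
        exact hb₂.mul (Filter.EventuallyEq.refl _ _)

/-- The product rule for conditionally independent events, on an atom `{h = r}` of the
conditioning variable. -/
theorem CondIndepFun.measureReal_inter_mul {β γ δ : Type*} [MeasurableSpace β] [MeasurableSpace γ]
    [MeasurableSpace δ] [StandardBorelSpace Ω] {f : Ω → β} {g : Ω → γ} {h : Ω → δ}
    (hf : Measurable f) (hg : Measurable g) (hh : Measurable h)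
    (H : CondIndepFun (MeasurableSpace.comap h inferInstance) hh.comap_le f g μ)
    {s : Set β} {t : Set γ} (hs : MeasurableSet s) (ht : MeasurableSet t) {r : δ}
    (hr : MeasurableSet {r}) :
    μ.real (f ⁻¹' s ∩ g ⁻¹' t ∩ h ⁻¹' {r}) * μ.real (h ⁻¹' {r}) =
      μ.real (f ⁻¹' s ∩ h ⁻¹' {r}) * μ.real (g ⁻¹' t ∩ h ⁻¹' {r}) := by
  set R := h ⁻¹' {r} with hR
  have hRm : MeasurableSet[MeasurableSpace.comap h inferInstance] R := ⟨{r}, hr, rfl⟩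
  have hRm' : MeasurableSet R := hh.comap_le R hRm
  -- A conditional probability factors through `h`, hence is constant on the atom.
  have key : ∀ U : Set Ω, MeasurableSet U → ∃ k : ℝ,
      (∀ ω ∈ R, (μ⟦U | MeasurableSpace.comap h inferInstance⟧) ω = k) ∧
        μ.real (U ∩ R) = k * μ.real R := by
    intro U hU
    have hm : StronglyMeasurable[MeasurableSpace.comap h inferInstance]
      (μ⟦U | MeasurableSpace.comap h inferInstance⟧) := stronglyMeasurable_condExp
    obtain ⟨φ, -, hφ⟩ := hm.measurable.exists_eq_measurable_comp
    have hc : ∀ ω ∈ R, (μ⟦U | MeasurableSpace.comap h inferInstance⟧) ω = φ r := by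
      intro ω hω
      rw [hφ, Function.comp_apply, show h ω = r from hω]
    refine ⟨φ r, hc, ?_⟩
    have hi := setIntegral_condExp (f := U.indicator fun _ => (1 : ℝ)) (μ := μ) hh.comap_le
      ((integrable_const _).indicator hU) hRm
    rw [setIntegral_congr_fun (g := fun _ => φ r) hRm' hc, setIntegral_indicator hU] at hi
    simp only [setIntegral_const, smul_eq_mul, mul_one] at hi
    rw [Set.inter_comm, ← hi, mul_comm]
  obtain ⟨k, hk, hk'⟩ := key _ ((hf hs).inter (hg ht))
  obtain ⟨k₁, hk₁, hk₁'⟩ := key _ (hf hs)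
  obtain ⟨k₂, hk₂, hk₂'⟩ := key _ (hg ht)
  rw [hk', hk₁', hk₂']
  rcases eq_or_ne (μ R) 0 with h0 | h0
  · simp [measureReal_def, h0]
  · rw [condIndepFun_iff_condExp_inter_preimage_eq_mul hf hg] at H
    have hae := H s t hs ht
    -- An atom of positive measure contains a point where the almost sure identity holds.
    obtain ⟨ω, hωR, hω⟩ := ((frequently_ae_mem_iff.mpr h0).and_eventually hae).exists
    have : k = k₁ * k₂ := by rw [← hk ω hωR, ← hk₁ ω hωR, ← hk₂ ω hωR]; exact hω
    rw [this]; ring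

end Independence

-- Ancestral hulls, open walks, and paths that are not blocked.

namespace DAG

variable {V : Type u} (G : DAG V)

theorem adj_asymm {i j : V} (h : G.Adj i j) : ¬ G.Adj j i := fun h' =>
  G.acyclic i (.tail (.single h) h')

/-- The nodes of `R` and their ancestors. -/
def ancestralHull (R : Set V) : Set V := {i | ∃ j ∈ R, Relation.ReflTransGen G.Adj i j}

variable {G}

theorem subset_ancestralHull {R : Set V} : R ⊆ G.ancestralHull R := fun i hi => ⟨i, hi, .refl⟩

theorem mem_ancestralHull_of_adj {R : Set V} {i j : V} (h : G.Adj i j)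
    (hj : j ∈ G.ancestralHull R) : i ∈ G.ancestralHull R := by
  obtain ⟨k, hk, hjk⟩ := hj
  exact ⟨k, hk, .head h hjk⟩

theorem ancestralHull_mono {R R' : Set V} (h : R ⊆ R') :
    G.ancestralHull R ⊆ G.ancestralHull R' := fun _ ⟨j, hj, hij⟩ => ⟨j, h hj, hij⟩

variable (G)

/-- `i` and `j` are joined by a sequence of nodes of `H`, consecutive ones being joined by an edge
regardless of its direction. -/
def Linked (H : Set V) (i j : V) : Prop :=
  Relation.ReflTransGen (fun k l => (G.Adj k l ∨ G.Adj l k) ∧ k ∈ H ∧ l ∈ H) i j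

/-- Walks inside `H` that end in `j` and whose colliders all lie in `B`. Nodes may be repeated. -/
inductive OpenWalk (H B : Set V) (j : V) : List V → Prop
  | single : j ∈ H → OpenWalk H B j [j]
  | cons {i n : V} {q : List V} : (G.Adj i n ∨ G.Adj n i) → i ∈ H →
      (∀ r s, q = r :: s → G.Adj i n → G.Adj r n → n ∈ B) → OpenWalk H B j (n :: q) →
      OpenWalk H B j (i :: n :: q)

variable {G}

namespace Linked

variable {H H' : Set V} {i j : V}

theorem mono (hH : H ⊆ H') (h : G.Linked H i j) : G.Linked H' i j :=
  Relation.ReflTransGen.mono (fun _ _ h => ⟨h.1, hH h.2.1, hH h.2.2⟩) _ _ h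

theorem symm (h : G.Linked H i j) : G.Linked H j i :=
  Relation.ReflTransGen.mono (fun _ _ h => ⟨h.1.symm, h.2.2, h.2.1⟩) _ _
    (Relation.ReflTransGen.swap _ _ h)

end Linked

namespace OpenWalk

variable {H B : Set V} {i j m n : V} {p q : List V}

theorem mem (h : G.OpenWalk H B j p) : ∀ m ∈ p, m ∈ H := by
  induction h with
  | single hj => simpa using hj
  | cons _ hi _ _ ih =>
    intro m hm
    rcases List.mem_cons.mp hm with rfl | hm
    exacts [hi, ih m hm]

theorem getLast?_eq (h : G.OpenWalk H B j p) : p.getLast? = some j := by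
  induction h with
  | single => rfl
  | cons _ _ _ _ ih => rw [List.getLast?_cons_cons, ih]

theorem isChain (h : G.OpenWalk H B j p) : p.IsChain (fun k l => G.Adj k l ∨ G.Adj l k) := by
  induction h with
  | single => simp
  | cons h _ _ _ ih => exact List.isChain_cons_cons.mpr ⟨h, ih⟩

theorem collider_mem (h : G.OpenWalk H B j p) {l r : V} (hp : [l, m, r] <:+: p)
    (hl : G.Adj l m) (hr : G.Adj r m) : m ∈ B := by
  induction h with
  | single => simpa using hp.length_le
  | @cons i n q _ _ hc _ ih =>
    rcases List.infix_cons_iff.mp hp with hp | hp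
    · obtain ⟨t, ht⟩ := hp
      simp only [List.cons_append, List.nil_append, List.cons.injEq] at ht
      obtain ⟨rfl, rfl, rfl⟩ := ht
      exact hc _ _ rfl hl hr
    · exact ih hp

theorem exists_triple (h : G.OpenWalk H B j p) (hm : m ∈ p) (hj : m ≠ j) :
    p.head? = some m ∨ ∃ l r, [l, m, r] <:+: p ∧ (G.Adj l m ∨ G.Adj m l) ∧
      (G.Adj m r ∨ G.Adj r m) := by
  induction h with
  | single => simp_all
  | @cons i n q hin _ _ hw ih =>
    rcases List.mem_cons.mp hm with rfl | hm
    · exact .inl rfl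
    · rcases ih hm with h | ⟨l, r, hp, h⟩
      · obtain rfl : n = m := by simpa using h
        cases hw with
        | single => exact absurd rfl hj
        | @cons _ r q hnr => exact .inr ⟨i, r, ⟨[], q, rfl⟩, hin, hnr⟩
      · exact .inr ⟨l, r, List.infix_cons_iff.mpr (.inr hp), h⟩

theorem of_append {l : List V} (h : G.OpenWalk H B j (l ++ n :: q)) :
    G.OpenWalk H B j (n :: q) := by
  induction l with
  | nil => exact h
  | cons i l ih =>
    generalize ht : l ++ n :: q = t at ih
    rw [List.cons_append, ht] at h
    cases h with
    | single => simp at ht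
    | cons _ _ _ hw => exact ih hw

/-- A walk that starts with an edge out of `i` leads down to each of its later nodes, or to a
collider. -/
theorem mem_or_ancestor (hB : ∀ k l, G.Adj k l → l ∈ B → k ∈ B)
    (h : G.OpenWalk H B j (i :: n :: q)) (hin : G.Adj i n) (hm : m ∈ n :: q) :
    i ∈ B ∨ G.Ancestor i m := by
  induction q generalizing i n with
  | nil =>
    obtain rfl : m = n := by simpa using hm
    exact .inr (.single hin)
  | cons r q ih =>
    rcases List.mem_cons.mp hm with rfl | hm
    · exact .inr (.single hin)
    · cases h with
      | cons _ _ hc hw =>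
        by_cases hnr : G.Adj n r
        · exact (ih hw hnr hm).imp (hB i n hin) (fun h => .head hin h)
        · have hrn : G.Adj r n := by
            cases hw with
            | cons h => exact h.resolve_left hnr
          exact .inl (hB i n hin (hc _ _ rfl hin hrn))

/-- Cycles can be cut out of a walk without creating colliders outside of `B`. -/
theorem exists_nodup (hB : ∀ k l, G.Adj k l → l ∈ B → k ∈ B) (h : G.OpenWalk H B j p) :
    ∀ i t, p = i :: t → ∃ t', G.OpenWalk H B j (i :: t') ∧ (i :: t').Nodup ∧
      ∀ r s, t' = r :: s → G.Adj r i → i ∈ B ∨ ∃ r' s', t = r' :: s' ∧ G.Adj r' i := by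
  induction h with
  | single hj =>
    rintro i t ⟨⟩
    exact ⟨[], .single hj, by simp, by simp⟩
  | @cons i n q hin hi hc hw ih =>
    rintro _ _ ⟨⟩
    obtain ⟨t, ht, hnd, hfst⟩ := ih n q rfl
    have hcons : G.OpenWalk H B j (i :: n :: t) := by
      refine .cons hin hi (fun r s hrs hin hrn => ?_) ht
      rcases hfst r s hrs hrn with h | ⟨r', s', rfl, h⟩
      exacts [h, hc r' s' rfl hin h]
    by_cases hmem : i ∈ n :: t
    · obtain ⟨l, s, hls⟩ := List.append_of_mem hmem
      rw [hls] at ht hnd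
      refine ⟨s, ht.of_append, hnd.sublist (List.sublist_append_right _ _), ?_⟩
      rintro r s rfl hri
      -- After the cycle at `i` is cut, an edge into `i` is harmless if the old first edge also
      -- entered `i`. Otherwise the cycle leaves `i` by an outgoing edge; by acyclicity it must meet
      -- a collider below `i`, which puts `i` in `B`.
      by_cases hni : G.Adj n i
      · exact .inr ⟨n, q, rfl, hni⟩
      · exact .inl ((hcons.mem_or_ancestor hB (hin.resolve_right hni) hmem).resolve_right
          (G.acyclic i))
    · refine ⟨n :: t, hcons, List.nodup_cons.mpr ⟨hmem, hnd⟩, ?_⟩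
      rintro r s ⟨⟩ hni
      exact .inr ⟨_, q, rfl, hni⟩

/-- A directed path down to `j` has no colliders. Since it leaves `i` by an outgoing edge, a further
step can be put in front without making `i` a collider. -/
theorem exists_of_reflTransGen (hH : ∀ k l, G.Adj k l → l ∈ H → k ∈ H) (hj : j ∈ H)
    (h : Relation.ReflTransGen G.Adj i j) :
    i ∈ H ∧ ∃ q, G.OpenWalk H B j (i :: q) ∧ ∀ r s, q = r :: s → ¬ G.Adj r i := by
  induction h using Relation.ReflTransGen.head_induction_on with
  | refl => exact ⟨hj, [], .single hj, by simp⟩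
  | @head i k hik _ ih =>
    obtain ⟨hk, q, hq, hr⟩ := ih
    have hi := hH i k hik hk
    refine ⟨hi, k :: q, .cons (.inl hik) hi (fun r s hrs _ h => absurd h (hr r s hrs)) hq, ?_⟩
    rintro r s ⟨⟩
    exact G.adj_asymm hik

/-- The directed path from `n` to `i` is put in front in reverse; every node passed has an outgoing
edge on it, so no collider arises. -/
theorem exists_append_of_reflTransGen (hH : ∀ k l, G.Adj k l → l ∈ H → k ∈ H) (hi : i ∈ H)
    (h : Relation.ReflTransGen G.Adj n i) (hn : G.OpenWalk H B j (n :: q)) :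
    ∃ q', G.OpenWalk H B j (i :: q') := by
  have hmem : ∀ k, Relation.ReflTransGen G.Adj k i → k ∈ H := by
    intro k hk
    induction hk using Relation.ReflTransGen.head_induction_on with
    | refl => exact hi
    | head h _ ih => exact hH _ _ h ih
  induction h using Relation.ReflTransGen.head_induction_on generalizing q with
  | refl => exact ⟨q, hn⟩
  | @head n k hnk hk ih =>
    exact ih (.cons (.inr hnk) (hmem k hk) (fun _ _ _ h => absurd h (G.adj_asymm hnk)) hn)

end OpenWalk

/-- Build the walk backwards from `j`. A new collider is an ancestor-or-self of a node of `X`, of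
`i` or of `j`. In the first case it is allowed; in the second the walk descends to `i` and is
finished; in the third the old tail is replaced by a directed path to `j`. -/
theorem Linked.exists_openWalk {X : Set V} {i j : V}
    (h : G.Linked (G.ancestralHull (insert i (insert j X))) i j) :
    ∃ q, G.OpenWalk (G.ancestralHull (insert i (insert j X))) (G.ancestralHull X) j (i :: q) := by
  set H := G.ancestralHull (insert i (insert j X)) with hHdef
  have hH : ∀ k l, G.Adj k l → l ∈ H → k ∈ H := fun k l => mem_ancestralHull_of_adj
  have hi : i ∈ H := subset_ancestralHull (by simp)
  have hj : j ∈ H := subset_ancestralHull (by simp)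
  have key : ∀ n, G.Linked H j n → (∃ q, G.OpenWalk H (G.ancestralHull X) j (i :: q)) ∨
      ∃ q, G.OpenWalk H (G.ancestralHull X) j (n :: q) := by
    intro n hn
    induction hn with
    | refl => exact .inr ⟨[], .single hj⟩
    | @tail n n' _ hstep ih =>
      obtain ⟨hadj, ⟨w, hw, hnw⟩, hn'⟩ := hstep
      rcases ih with h | ⟨q, hq⟩
      · exact .inl h
      · rcases hw with rfl | rfl | hw
        · exact .inl (OpenWalk.exists_append_of_reflTransGen hH hi hnw hq)
        · obtain ⟨-, q', hq', hr⟩ := OpenWalk.exists_of_reflTransGen (B := G.ancestralHull X)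
            hH hj hnw
          exact .inr ⟨n :: q', .cons hadj.symm hn' (fun r s hrs _ h => absurd h (hr r s hrs)) hq'⟩
        · exact .inr ⟨n :: q, .cons hadj.symm hn' (fun _ _ _ _ _ => ⟨w, hw, hnw⟩) hq⟩
  exact (key i h.symm).elim id id

/-- Two nodes linked inside the ancestral hull of themselves and of `W` are joined by a path which is
unblocked by some subset of `W`. -/
theorem Linked.exists_not_blocked [Finite V] {W : Set V} {i j : V} (hi : i ∉ W) (hj : j ∉ W)
    (h : G.Linked (G.ancestralHull (insert i (insert j W))) i j) :
    ∃ X ⊆ W, ∃ p, G.IsPath i j p ∧ ¬ G.Blocked p X := by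
  obtain ⟨X, ⟨hXW, hX⟩, hmin⟩ := exists_minimal_of_wellFoundedLT
    (fun X => X ⊆ W ∧ G.Linked (G.ancestralHull (insert i (insert j X))) i j) ⟨W, subset_rfl, h⟩
  set H := G.ancestralHull (insert i (insert j X)) with hH
  -- If `x` had a child in `H`, dropping `x` would leave the hull unchanged, because the child leads
  -- to another generator; this contradicts minimality. So both path edges at an inner node of `X`
  -- point into it, making it a collider.
  have hout : ∀ x ∈ X, ∀ n ∈ H, ¬ G.Adj x n := by
    rintro x hx n ⟨w, hw, hnw⟩ hxn
    have hwx : w ≠ x := by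
      rintro rfl
      exact G.acyclic w (Relation.TransGen.head' hxn hnw)
    have hsub : H ⊆ G.ancestralHull (insert i (insert j (X \ {x}))) := by
      have hins : ∀ k ∈ insert i (insert j X), k ≠ x → k ∈ insert i (insert j (X \ {x})) := by
        rintro k (rfl | rfl | hk) hkx <;> simp_all
      rintro k ⟨l, hl, hkl⟩
      by_cases hlx : l = x
      · subst hlx
        exact ⟨w, hins w hw hwx, hkl.trans (.head hxn hnw)⟩
      · exact ⟨l, hins l hl hlx, hkl⟩
    have := hmin (y := X \ {x}) ⟨Set.sdiff_subset.trans hXW, hX.mono hsub⟩ Set.sdiff_subset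
    exact (this hx).2 rfl
  obtain ⟨q, hq⟩ := hX.exists_openWalk
  obtain ⟨t, ht, hnd, -⟩ := hq.exists_nodup (fun _ _ => mem_ancestralHull_of_adj) i q rfl
  refine ⟨X, hXW, i :: t, ⟨hnd, rfl, ht.getLast?_eq, ht.isChain⟩, ?_⟩
  rintro (⟨m, hm, hmX, hc⟩ | ⟨m, ⟨l, r, hp, hl, hr⟩, hmX, hd⟩)
  · rcases ht.exists_triple hm (by rintro rfl; exact hj (hXW hmX)) with h | ⟨l, r, hp, hl, hr⟩
    · obtain rfl : i = m := by simpa using h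
      exact hi (hXW hmX)
    · refine hc ⟨l, r, hp, hl.resolve_right ?_, hr.resolve_left ?_⟩
      · exact hout m hmX l (ht.mem l (hp.subset (by simp)))
      · exact hout m hmX r (ht.mem r (hp.subset (by simp)))
  · obtain ⟨x, hx, hmx⟩ := ht.collider_mem hp hl hr
    rcases Relation.reflTransGen_iff_eq_or_transGen.mp hmx with rfl | h
    exacts [hmX hx, hd x h hx]

variable (G) in
/-- The diagram without the edges at `A`. -/
def isolate (A : V) : DAG V where
  Adj i j := G.Adj i j ∧ i ≠ A ∧ j ≠ A
  acyclic i h := G.acyclic i (Relation.TransGen.mono (fun _ _ h => h.1) _ _ h)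

theorem isolate_ancestor {A i j : V} (h : (G.isolate A).Ancestor i j) : G.Ancestor i j :=
  Relation.TransGen.mono (fun _ _ h => h.1) _ _ h

/-- A path without edges at `A` that starts elsewhere never visits `A`, so conditioning on `A`
cannot block it; restoring edges only adds descendants, which can only help to open colliders. -/
theorem exists_not_blocked_of_isolate {A i j : V} (hiA : i ≠ A) {p : List V} {X : Set V}
    (hp : (G.isolate A).IsPath i j p) (hX : ¬ (G.isolate A).Blocked p X) :
    G.IsPath i j p ∧ ¬ G.Blocked p (insert A X) := by
  obtain ⟨hnd, hhd, hlast, hch⟩ := hp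
  have hA : ∀ m ∈ p, m ≠ A := by
    clear hnd hlast hX
    induction p generalizing i with
    | nil => simp
    | cons k q ih =>
      obtain rfl : k = i := by simpa using hhd
      intro m hm
      rcases List.mem_cons.mp hm with rfl | hm
      · exact hiA
      · cases q with
        | nil => simp at hm
        | cons n q =>
          rw [List.isChain_cons_cons] at hch
          exact ih (i := n) (hch.1.elim (fun h => h.2.2) fun h => h.2.1) rfl hch.2 m hm
  have hcol : ∀ m, G.IsCollider p m ↔ (G.isolate A).IsCollider p m := by
    refine fun m => ⟨?_, ?_⟩
    · rintro ⟨l, r, h, hl, hr⟩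
      have := hA l (h.subset (by simp))
      have := hA m (h.subset (by simp))
      have := hA r (h.subset (by simp))
      exact ⟨l, r, h, ⟨hl, ‹_›, ‹_›⟩, ⟨hr, ‹_›, ‹_›⟩⟩
    · rintro ⟨l, r, h, hl, hr⟩
      exact ⟨l, r, h, hl.1, hr.1⟩
  refine ⟨⟨hnd, hhd, hlast, hch.imp fun _ _ h => h.imp And.left And.left⟩, fun h => hX ?_⟩
  rcases h with ⟨m, hm, hmX, hc⟩ | ⟨m, hc, hmX, hd⟩
  · exact .inl ⟨m, hm, hmX.resolve_left (hA m hm), fun h => hc ((hcol m).mpr h)⟩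
  · exact .inr ⟨m, (hcol m).mp hc, fun h => hmX (.inr h),
      fun d hmd hdX => hd d (isolate_ancestor hmd) (.inr hdX)⟩

variable {V : Type u} {G : DAG V} {i j : V} {R : Set V}

theorem not_dSep_of_not_blocked {p : List V} (hp : G.IsPath i j p) (h : ¬ G.Blocked p R) :
    ¬ G.DSep {i} {j} R := fun hd => h (hd i rfl j rfl p hp)

theorem not_dSep_of_adj (h : G.Adj i j ∨ G.Adj j i) (hi : i ∉ R) (hj : j ∉ R) :
    ¬ G.DSep {i} {j} R := by
  have hij : i ≠ j := by
    rintro rfl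
    exact G.acyclic i (.single (h.elim id id))
  have hc : ∀ m, ¬ G.IsCollider [i, j] m := by
    rintro m ⟨l, r, hp, -⟩
    simpa using hp.length_le
  refine not_dSep_of_not_blocked (p := [i, j]) ⟨by simpa using hij, rfl, rfl, by simpa using h⟩ ?_
  rintro (⟨m, hm, hmR, -⟩ | ⟨m, hm, -⟩)
  · simp only [List.mem_cons, List.not_mem_nil, or_false] at hm
    rcases hm with rfl | rfl
    exacts [hi hmR, hj hmR]
  · exact hc m hm

theorem IsPreExposure.notMem_ancestralHull_isolate {A Y : V} {Pre : Set V} (hAY : A ≠ Y)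
    (h : G.IsPreExposure A Y Pre) : A ∉ (G.isolate A).ancestralHull (insert Y Pre) := by
  rintro ⟨k, hk, hAk⟩
  rcases Relation.ReflTransGen.cases_head hAk with rfl | ⟨l, hl, -⟩
  · rcases hk with hk | hk
    exacts [hAY hk, h.exposure_notMem hk]
  · exact hl.2.1 rfl

end DAG

-- No confounding from a split of the errors, and part (i).

namespace CausalModel

variable {V : Type u} {G : DAG V} {val : V → Type v} [∀ i, MeasurableSpace (val i)]
  (M : CausalModel.{u, v, w, w'} G val)

theorem measurable_f_comp {Ω' : Type*} {m : MeasurableSpace Ω'} {i : V}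
    {g : Ω' → ∀ j : {j // G.Adj j i}, val j} {e : Ω' → M.Noise i}
    (hg : ∀ j, Measurable fun ω => g ω j) (he : Measurable e) :
    Measurable fun ω => M.f i (g ω) (e ω) :=
  (M.measurable_f i).comp ((measurable_pi_lambda _ hg).prodMk he)

variable [Finite V]

/-- If `D` is closed under taking those parents that are not set to a constant, then the variables
at the nodes of `D` are functions of the errors of the nodes of `D`. -/
theorem measurable_solve_iSup (s : ∀ i, Option (val i)) {D : Set V}
    (hD : ∀ i ∈ D, ∀ j, G.Adj j i → s j = none → j ∈ D) {i : V} (hi : i ∈ D) :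
    Measurable[⨆ j ∈ D, MeasurableSpace.comap (M.ε j) inferInstance] (fun ω => M.solve s ω i) := by
  induction i using G.wellFounded.induction with
  | _ i ih =>
    simp only [M.solve_eq s _ i]
    cases hs : s i with
    | some x => exact measurable_const
    | none =>
      refine M.measurable_f_comp (fun j => ?_) ?_
      · cases hj : s j with
        | some x =>
          have : (fun ω => M.solve s ω j) = fun _ => x := by
            funext ω
            rw [M.solve_eq, hj, Option.getD_some]
          rw [this]
          exact measurable_const
        | none => exact ih j j.2 (hD i hi j j.2 hj)
      · exact measurable_iff_comap_le.mpr
          (le_iSup₂_of_le (f := fun j _ => MeasurableSpace.comap (M.ε j) inferInstance) i hi le_rfl)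

/-- The recursion at `i` never reaches the exposure. Measurability statements about the intervened
model thus transfer to observed nondescendants. -/
theorem solve_update_eq_obs_of_not_ancestor [DecidableEq V] {A i : V} (a : val A) (ω : M.Ω)
    (hiA : i ≠ A) (hi : ¬ G.Ancestor A i) :
    M.solve (Function.update (fun _ => none) A (some a)) ω i = M.obs i ω := by
  induction i using G.wellFounded.induction with
  | _ i ih =>
    rw [obs, M.solve_eq, M.solve_eq, Function.update_of_ne hiA]
    congr 2
    funext j
    refine ih j j.2 ?_ fun h => hi (.tail h j.2)
    intro h
    exact hi (.single (h ▸ j.2))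

theorem comap_obsOn (S : Set V) :
    MeasurableSpace.comap (M.obsOn S) inferInstance =
      ⨆ i ∈ S, MeasurableSpace.comap (M.obs i) inferInstance := by
  rw [iSup_subtype']
  simp only [MeasurableSpace.pi, MeasurableSpace.comap_iSup, MeasurableSpace.comap_comp]
  rfl

/-- There is no confounding conditional on `S` if the nodes of `S`, the outcome and the parents of
the exposure outside of `S` can be divided into two sets, the outcome in one and the parents in the
other, that share no error variables. -/
theorem noConfounding_of_split {A Y : V} {S D E : Set V} (hDE : Disjoint D E) (hAD : A ∉ D)
    (hAE : A ∉ E) (hD : ∀ i ∈ D, ∀ j, G.Adj j i → j ≠ A → j ∈ D)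
    (hE : ∀ i ∈ E, ∀ j, G.Adj j i → j ≠ A → j ∈ E) (hY : Y ∈ E) (hS : S ⊆ D ∪ E)
    (hpa : ∀ j, G.Adj j A → j ∈ D ∪ S) (hSA : ∀ i ∈ S, ¬ G.Ancestor A i) :
    M.NoConfounding A Y S := by
  classical
  intro a
  set s : ∀ i, Option (val i) := Function.update (fun _ => none) A (some a) with hs
  have hs' : ∀ j, s j = none → j ≠ A := by
    rintro j hj rfl
    simp [hs] at hj
  let e : V → MeasurableSpace M.Ω := fun j => MeasurableSpace.comap (M.ε j) inferInstance
  let o : V → MeasurableSpace M.Ω := fun j => MeasurableSpace.comap (M.obs j) inferInstance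
  have he : ∀ j, e j ≤ M.measurableSpaceΩ := fun j => (M.measurable_ε j).comap_le
  have hoD : ∀ i ∈ D, ¬ G.Ancestor A i → o i ≤ ⨆ j ∈ D, e j := by
    intro i hi hAi
    have h := M.measurable_solve_iSup s (fun i hi j hji hj => hD i hi j hji (hs' j hj)) hi
    simp only [hs, M.solve_update_eq_obs_of_not_ancestor a _ (ne_of_mem_of_not_mem hi hAD) hAi]
      at h
    exact h.comap_le
  have hoE : ∀ i ∈ E, ¬ G.Ancestor A i → o i ≤ ⨆ j ∈ E, e j := by
    intro i hi hAi
    have h := M.measurable_solve_iSup s (fun i hi j hji hj => hE i hi j hji (hs' j hj)) hi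
    simp only [hs, M.solve_update_eq_obs_of_not_ancestor a _ (ne_of_mem_of_not_mem hi hAE) hAi]
      at h
    exact h.comap_le
  -- The exposure's own error belongs to neither `D` nor `E`; it joins the side of `D`.
  set m₁ : MeasurableSpace M.Ω := ⨆ j ∈ insert A D, e j with hm₁
  set m₂ : MeasurableSpace M.Ω := ⨆ j ∈ E, e j with hm₂
  have hDm₁ : ⨆ j ∈ D, e j ≤ m₁ := biSup_mono fun j hj => Set.mem_insert_of_mem A hj
  have hind : Indep m₁ m₂ M.P :=
    indep_iSup_of_disjoint he M.indep_ε.iIndep (Set.disjoint_insert_left.mpr ⟨hAE, hDE⟩)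
  set n₁ : MeasurableSpace M.Ω := ⨆ i ∈ S ∩ D, o i with hn₁
  set n₂ : MeasurableSpace M.Ω := ⨆ i ∈ S ∩ E, o i with hn₂
  have hn₁m : n₁ ≤ m₁ := iSup₂_le fun i hi => (hoD i hi.2 (hSA i hi.1)).trans hDm₁
  have hn₂m : n₂ ≤ m₂ := iSup₂_le fun i hi => hoE i hi.2 (hSA i hi.1)
  have hn : MeasurableSpace.comap (M.obsOn S) inferInstance = n₁ ⊔ n₂ := by
    rw [comap_obsOn, hn₁, hn₂, ← iSup_union, ← Set.inter_union_distrib_left,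
      Set.inter_eq_left.mpr hS]
  have hle : n₁ ⊔ n₂ ≤ M.measurableSpaceΩ := hn ▸ (M.measurable_obsOn S).comap_le
  have hYm : MeasurableSpace.comap (M.potential A a Y) inferInstance ≤ m₂ := by
    have h := M.measurable_solve_iSup s (fun i hi j hji hj => hE i hi j hji (hs' j hj)) hY
    exact h.comap_le
  have hAm : MeasurableSpace.comap (M.obs A) inferInstance ≤ m₁ ⊔ n₂ := by
    refine Measurable.comap_le ?_
    have : M.obs A = fun ω => M.f A (fun j => M.obs j.1 ω) (M.ε A ω) := by
      funext ω
      exact M.solve_eq _ ω A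
    rw [this]
    refine M.measurable_f_comp (fun j => ?_) ?_
    · have hjA : ¬ G.Ancestor A j := fun h => G.acyclic A (.tail h j.2)
      have hjD : j.1 ∈ D → o j ≤ m₁ ⊔ n₂ := fun h =>
        ((hoD j h hjA).trans hDm₁).trans le_sup_left
      refine measurable_iff_comap_le.mpr ?_
      rcases hpa j j.2 with h | h
      · exact hjD h
      · rcases hS h with h' | h'
        · exact hjD h'
        · exact (le_iSup₂_of_le (f := fun i (_ : i ∈ S ∩ E) => o i) j.1 ⟨h, h'⟩ le_rfl).trans
            le_sup_right
    · exact measurable_iff_comap_le.mpr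
        ((le_iSup₂_of_le (f := fun i (_ : i ∈ insert A D) => e i) A (Set.mem_insert _ _)
          le_rfl).trans le_sup_left)
  have h := condIndep_sup_of_indep (iSup₂_le fun j _ => he j) (iSup₂_le fun j _ => he j) hind
    hn₁m hn₂m hle
  rw [condIndepFun_iff_condIndep]
  have h' := condIndep_of_condIndep_of_le_left (condIndep_of_condIndep_of_le_right h hAm) hYm
  convert h'

/-- The potential outcome and the exposure are conditionally independent given all the confounders
in the sense of the association-based definition. -/
theorem Faithful.noConfounding_assocConfounders {M : CausalModel.{u, v, w, w'} G val} {A Y : V}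
    {Pre : Set V} (hM : M.Faithful) (hAY : A ≠ Y) (hPre : G.IsPreExposure A Y Pre) :
    M.NoConfounding A Y (M.assocConfounders Pre A Y) := by
  set S := M.assocConfounders Pre A Y with hS
  set H := (G.isolate A).ancestralHull (insert Y Pre) with hH
  set K : Set V := {i | i ∈ H ∧ ∃ C, G.Adj C A ∧ C ∉ S ∧ (G.isolate A).Linked H C i} with hK
  have hAH : A ∉ H := hPre.notMem_ancestralHull_isolate hAY
  have hPreH : Pre ⊆ H := (Set.subset_insert _ _).trans DAG.subset_ancestralHull
  have hSPre : S ⊆ Pre := fun C hC => hC.1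
  have hadj : ∀ i ∈ H, ∀ j, G.Adj j i → j ≠ A → (G.isolate A).Adj j i ∧ j ∈ H := by
    intro i hi j hji hj
    have h : (G.isolate A).Adj j i := ⟨hji, hj, ne_of_mem_of_not_mem hi hAH⟩
    exact ⟨h, DAG.mem_ancestralHull_of_adj h hi⟩
  have hYK : Y ∉ K := by
    rintro ⟨-, C, hCA, hCS, hlink⟩
    have hCPre : C ∈ Pre := hPre.ancestor_mem C (.single hCA)
    have hCA' : C ≠ A := ne_of_mem_of_not_mem hCPre hPre.exposure_notMem
    have hCY : C ≠ Y := ne_of_mem_of_not_mem hCPre hPre.outcome_notMem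
    -- As an endpoint, `C` generates its own part of the hull, so the conditioning set can be sought
    -- in `Pre \ {C}`.
    have hsub : insert Y Pre ⊆ insert C (insert Y (Pre \ {C})) := by
      intro i hi
      by_cases hiC : i = C
      · exact .inl hiC
      · exact .inr (hi.imp id fun h => ⟨h, hiC⟩)
    obtain ⟨X, hXsub, p, hp, hpX⟩ := (hlink.mono (DAG.ancestralHull_mono hsub)).exists_not_blocked
      (by simp) (fun h => hPre.outcome_notMem h.1)
    obtain ⟨hp, hpX⟩ := DAG.exists_not_blocked_of_isolate hCA' hp hpX
    have hCX : C ∉ X := fun h => (hXsub h).2 rfl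
    have hAX : A ∉ X := fun h => hPre.exposure_notMem (hXsub h).1
    have hYX : Y ∉ X := fun h => hPre.outcome_notMem (hXsub h).1
    refine hCS ⟨hCPre, X, hXsub.trans Set.sdiff_subset, fun h => ?_, fun h => ?_⟩
    · exact DAG.not_dSep_of_adj (.inl hCA) hCX hAX
        (hM _ _ _ (by simpa using hCA') (by simpa) (by simpa) h)
    · exact DAG.not_dSep_of_not_blocked hp hpX
        (hM _ _ _ (by simpa using hCY) (by simp [hCA', hCX]) (by simp [hAY.symm, hYX]) h)
  refine M.noConfounding_of_split (D := K) (E := H \ K) Set.disjoint_sdiff_right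
    (fun h => hAH h.1) (fun h => hAH h.1) ?_ ?_
    ⟨DAG.subset_ancestralHull (Set.mem_insert _ _), hYK⟩ ?_ ?_
    (fun i hi => hPre.nondescendant i (hSPre hi))
  · rintro i ⟨hi, C, hCA, hCS, hl⟩ j hji hj
    obtain ⟨h, hjH⟩ := hadj i hi j hji hj
    exact ⟨hjH, C, hCA, hCS, hl.tail ⟨.inr h, hi, hjH⟩⟩
  · rintro i ⟨hi, hiK⟩ j hji hj
    obtain ⟨h, hjH⟩ := hadj i hi j hji hj
    refine ⟨hjH, ?_⟩
    rintro ⟨-, C, hCA, hCS, hl⟩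
    exact hiK ⟨hi, C, hCA, hCS, hl.tail ⟨.inl h, hjH, hi⟩⟩
  · intro i hi
    by_cases hiK : i ∈ K
    exacts [.inl hiK, .inr ⟨hPreH (hSPre hi), hiK⟩]
  · intro j hj
    by_cases hjS : j ∈ S
    · exact .inr hjS
    · exact .inl ⟨hPreH (hPre.ancestor_mem j (.single hj)), j, hj, hjS, .refl⟩

section

variable {V : Type u} [Finite V] {G : DAG V} {val : V → Type v} [∀ i, MeasurableSpace (val i)]
  (M : CausalModel.{u, v, w, w'} G val)

theorem measurable_obs (i : V) : Measurable (M.obs i) := M.measurable_solve _ i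

theorem measurable_potential (A : V) (a : val A) (Y : V) : Measurable (M.potential A a Y) :=
  M.measurable_solve _ Y

theorem obs_eq (i : V) (ω : M.Ω) : M.obs i ω = M.f i (fun j => M.obs j ω) (M.ε i ω) :=
  M.solve_eq _ ω i

/-- Consistency: if the exposure has the value `a`, then the outcome is the potential outcome under
`a`. -/
theorem potential_eq_obs {A Y : V} {a : val A} {ω : M.Ω} (h : M.obs A ω = a) :
    M.potential A a Y ω = M.obs Y ω := by
  classical
  have key : ∀ i, M.solve (Function.update (fun _ => none) A (some a)) ω i = M.obs i ω := by
    intro i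
    induction i using G.wellFounded.induction with
    | _ i ih =>
      rw [M.solve_eq]
      by_cases hi : i = A
      · subst hi
        simp [h]
      · rw [Function.update_of_ne hi, obs_eq]
        exact congrArg (fun x => M.f i x (M.ε i ω)) (funext fun j => ih j j.2)
  exact key Y

/-- By acyclicity, a joint value is attained exactly when each equation holds at that value
separately. This turns the event into one condition per error and lets its probability factor. -/
theorem forall_obs_eq_iff (x : ∀ i, val i) (ω : M.Ω) :
    (∀ i, M.obs i ω = x i) ↔ ∀ i, M.f i (fun j => x j) (M.ε i ω) = x i := by
  refine ⟨fun h i => ?_, fun h i => ?_⟩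
  · rw [← h i, M.obs_eq]
    simp only [h]
  · induction i using G.wellFounded.induction with
    | _ i ih =>
      rw [M.obs_eq, ← h i]
      exact congrArg (fun x => M.f i x (M.ε i ω)) (funext fun j => ih j j.2)

end

-- Adjustment is unbiased when there is no confounding.

section Standardization

variable {V : Type u} [Fintype V] {G : DAG V} {val : V → Type v} [∀ i, MeasurableSpace (val i)]
  {M : CausalModel.{u, v, w, w'} G val}

theorem FullSupport.measure_obs_obsOn_ne_zero (hM : M.FullSupport) {A : V} {X : Set V}
    (hA : A ∉ X) (a : val A) (x : ∀ i : X, val i) :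
    M.P {ω | M.obs A ω = a ∧ M.obsOn X ω = x} ≠ 0 := by
  classical
  obtain ⟨ω₀⟩ : Nonempty M.Ω := nonempty_of_isProbabilityMeasure M.P
  let z : ∀ i, val i := fun i => if h : i ∈ X then x ⟨i, h⟩ else M.obs i ω₀
  refine ne_of_gt (lt_of_lt_of_le (hM (Function.update z A a)) (measure_mono ?_))
  refine fun ω hω => ⟨?_, ?_⟩
  · simpa using hω A
  · funext i
    have hi : (i : V) ≠ A := ne_of_mem_of_not_mem i.2 hA
    have := hω i
    rw [Function.update_of_ne hi] at this
    simpa [z, obsOn] using this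

theorem setIntegral_comp_eq_sum {Ω β : Type*} [MeasurableSpace Ω] {μ : Measure Ω}
    [IsFiniteMeasure μ] [Fintype β] [MeasurableSpace β] [MeasurableSingletonClass β] {Z : Ω → β}
    (hZ : Measurable Z) (y : β → ℝ) (s : Set Ω) :
    ∫ ω in s, y (Z ω) ∂μ = ∑ b, y b * μ.real (Z ⁻¹' {b} ∩ s) := by
  rw [← integral_map (φ := Z) hZ.aemeasurable (measurable_of_finite y).aestronglyMeasurable,
    integral_fintype Integrable.of_finite]
  refine Finset.sum_congr rfl fun b _ => ?_
  rw [map_measureReal_apply hZ (measurableSet_singleton b),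
    measureReal_restrict_apply (hZ (measurableSet_singleton b)), smul_eq_mul, mul_comm]

variable [∀ i, Fintype (val i)] [∀ i, MeasurableSingletonClass (val i)]

/-- On `{A = a}` consistency replaces the outcome by the potential outcome, and independence on the
atom of `X` then removes the condition `A = a`. -/
theorem NoConfounding.condMean_mul {A Y : V} {X : Set V} (hX : M.NoConfounding A Y X)
    (y : val Y → ℝ) (a : val A) (x : ∀ i : X, val i)
    (hpos : M.P {ω | M.obs A ω = a ∧ M.obsOn X ω = x} ≠ 0) :
    M.condMean A Y y a X x * M.P.real {ω | M.obsOn X ω = x} =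
      ∫ ω in M.obsOn X ⁻¹' {x}, y (M.potential A a Y ω) ∂M.P := by
  set E := {ω | M.obs A ω = a ∧ M.obsOn X ω = x} with hE
  have hEeq : E = M.obs A ⁻¹' {a} ∩ M.obsOn X ⁻¹' {x} := rfl
  have hEm : MeasurableSet E := by
    rw [hEeq]
    exact (M.measurable_obs A (measurableSet_singleton a)).inter
      (M.measurable_obsOn X (measurableSet_singleton x))
  have hE0 : M.P.real E ≠ 0 := by
    rw [measureReal_ne_zero_iff]
    exact hpos
  have h₁ : M.condMean A Y y a X x = (M.P.real E)⁻¹ *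
      ∑ b, y b * M.P.real (M.potential A a Y ⁻¹' {b} ∩ E) := by
    rw [condMean, ← hE, ProbabilityTheory.cond, integral_smul_measure, smul_eq_mul,
      ENNReal.toReal_inv, ← setIntegral_comp_eq_sum (M.measurable_potential A a Y)]
    congr 1
    exact setIntegral_congr_fun hEm fun ω hω => by rw [M.potential_eq_obs hω.1]
  rw [h₁, setIntegral_comp_eq_sum (M.measurable_potential A a Y), mul_assoc, Finset.sum_mul,
    inv_mul_eq_iff_eq_mul₀ hE0, Finset.mul_sum]
  refine Finset.sum_congr rfl fun b _ => ?_
  have h₂ := CondIndepFun.measureReal_inter_mul (M.measurable_potential A a Y)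
    (M.measurable_obs A) (M.measurable_obsOn X) (hX a) (measurableSet_singleton b)
    (measurableSet_singleton a) (measurableSet_singleton x)
  rw [Set.inter_assoc, ← hEeq] at h₂
  rw [mul_assoc, show {ω | M.obsOn X ω = x} = M.obsOn X ⁻¹' {x} from rfl, h₂]
  ring

/-- If there is no confounding conditional on `X`, then adjusting for `X` is unbiased. -/
theorem NoConfounding.adjustedContrast_eq {A Y : V} {X : Set V} (hX : M.NoConfounding A Y X)
    (hM : M.FullSupport) (hA : A ∉ X) (y : val Y → ℝ) (a₁ a₀ : val A) :
    M.adjustedContrast A Y y a₁ a₀ X = M.causalContrast A Y y a₁ a₀ := by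
  classical
  have key : ∀ a, ∑ x, M.condMean A Y y a X x * M.P.real {ω | M.obsOn X ω = x} =
      ∫ ω, y (M.potential A a Y ω) ∂M.P := by
    intro a
    have hint : Integrable (fun ω => y (M.potential A a Y ω)) M.P :=
      Integrable.comp_measurable Integrable.of_finite (M.measurable_potential A a Y)
    have huniv : ⋃ x, M.obsOn X ⁻¹' {x} = Set.univ := by
      ext ω
      simp
    rw [← setIntegral_univ, ← huniv,
      integral_iUnion_fintype (fun x => M.measurable_obsOn X (measurableSet_singleton x)) ?_
        fun x => hint.integrableOn]
    · exact Finset.sum_congr rfl fun x _ =>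
        hX.condMean_mul y a x (hM.measure_obs_obsOn_ne_zero hA a x)
    · intro x x' hxx'
      exact Disjoint.preimage _ (by simpa using hxx')
  rw [causalContrast, ← key, ← key, adjustedContrast, ← Finset.sum_sub_distrib]
  exact Finset.sum_congr (by congr!) fun x _ => sub_mul _ _ _

end Standardization

section Bool

variable {V : Type u} [Finite V] {G : DAG V} (M : CausalModel.{u, 0, w, w'} G (fun _ => Bool))

/-- The probability that all variables in `F` are true. -/
noncomputable def probTrue (F : Set V) : ℝ := M.P.real {ω | ∀ i ∈ F, M.obs i ω = true}

variable {M}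

/-- Only the all-true events are retained from conditional independence; this necessary condition is
what the model is tested against. -/
theorem CondIndepNodes.probTrue_mul {S T R : Set V} (h : M.CondIndepNodes S T R) {i j : V}
    (hi : i ∈ S) (hj : j ∈ T) :
    M.probTrue (insert i (insert j R)) * M.probTrue R =
      M.probTrue (insert i R) * M.probTrue (insert j R) := by
  have hm : ∀ (U : Set V) (k : U), MeasurableSet {x : ∀ _ : U, Bool | x k = true} := by
    intro U k
    have h : Measurable fun x : ∀ _ : U, Bool => x k := measurable_pi_apply k
    exact h (measurableSet_singleton true)
  have key := CondIndepFun.measureReal_inter_mul (M.measurable_obsOn S) (M.measurable_obsOn T)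
    (M.measurable_obsOn R) h (hm S ⟨i, hi⟩) (hm T ⟨j, hj⟩)
    (measurableSet_singleton (fun _ : R => true))
  have hR : M.obsOn R ⁻¹' {fun _ => true} = {ω | ∀ k ∈ R, M.obs k ω = true} := by
    ext ω
    simp [obsOn, funext_iff]
  rw [hR] at key
  simp only [probTrue, Set.forall_mem_insert]
  convert key using 3 <;> ext ω <;> simp [obsOn, and_assoc]

end Bool

end CausalModel

-- Computable colliders, and a faithful model on the M-bias diagram.

namespace DAG

variable {V : Type u} {G : DAG V}

/-- The colliders of a path, in order. -/
def colliders (G : DAG V) [DecidableRel G.Adj] : List V → List V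
  | l :: m :: r :: t =>
    if G.Adj l m ∧ G.Adj r m then m :: colliders G (m :: r :: t) else colliders G (m :: r :: t)
  | _ => []

theorem isCollider_iff_mem_colliders [DecidableRel G.Adj] {p : List V} {m : V} :
    G.IsCollider p m ↔ m ∈ G.colliders p := by
  have hshort : ∀ q : List V, q.length < 3 → ¬ G.IsCollider q m := by
    rintro q hq ⟨l, r, hp, -⟩
    have := hp.length_le
    simp only [List.length_cons, List.length_nil] at this
    omega
  induction p with
  | nil => simpa [colliders] using hshort [] (by simp)
  | cons l p ih =>
    match p, ih with
    | [], _ => simpa [colliders] using hshort [l] (by simp)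
    | [k], _ => simpa [colliders] using hshort [l, k] (by simp)
    | n :: r :: t, ih =>
      have hcons : G.IsCollider (l :: n :: r :: t) m ↔
          (m = n ∧ G.Adj l n ∧ G.Adj r n) ∨ G.IsCollider (n :: r :: t) m := by
        constructor
        · rintro ⟨l', r', hp, hl, hr⟩
          rcases List.infix_cons_iff.mp hp with ⟨s, hs⟩ | hp
          · simp only [List.cons_append, List.nil_append, List.cons.injEq] at hs
            obtain ⟨rfl, rfl, rfl, -⟩ := hs
            exact .inl ⟨rfl, hl, hr⟩
          · exact .inr ⟨l', r', hp, hl, hr⟩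
        · rintro (⟨rfl, hl, hr⟩ | ⟨l', r', hp, hl, hr⟩)
          · exact ⟨l, r, ⟨[], t, rfl⟩, hl, hr⟩
          · exact ⟨l', r', List.infix_cons_iff.mpr (.inr hp), hl, hr⟩
      have ih' : G.IsCollider (n :: r :: t) m ↔ m ∈ G.colliders (n :: r :: t) := ih
      rw [hcons, ih', colliders]
      split_ifs with h <;> simp [h]

end DAG

namespace MNode

/-- The edges of the M-bias diagram, as a Boolean function. -/
def isEdge : MNode → MNode → Bool
  | c1, a => true
  | c1, c3 => true
  | c2, c3 => true
  | c2, y => true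
  | a, y => true
  | _, _ => false

theorem edge_iff {i j : MNode} : Edge i j ↔ isEdge i j = true := by
  constructor
  · rintro ⟨⟩ <;> rfl
  · cases i <;> cases j <;> intro h <;> first | exact absurd h (by decide) | constructor

instance : DecidableRel Edge := fun _ _ => decidable_of_iff _ edge_iff.symm

/-- The walks with at most `n` edges in the M-bias diagram that start in `i`. -/
def walks : ℕ → MNode → List (List MNode)
  | 0, i => [[i]]
  | n + 1, i => [i] :: ([c1, c2, c3, a, y].filter fun k => isEdge i k || isEdge k i).flatMap
      fun k => (walks n k).map (i :: ·)

theorem mem_walks {n : ℕ} {i : MNode} {t : List MNode}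
    (h : (i :: t).IsChain fun k l => Edge k l ∨ Edge l k) (hn : t.length ≤ n) :
    i :: t ∈ walks n i := by
  induction n generalizing i t with
  | zero =>
    obtain rfl : t = [] := List.length_eq_zero_iff.mp (by omega)
    simp [walks]
  | succ n ih =>
    cases t with
    | nil => simp [walks]
    | cons k t =>
      rw [List.isChain_cons_cons] at h
      have ht := ih h.2 (by simpa using hn)
      simp only [walks, List.mem_cons, List.mem_flatMap, List.mem_filter, List.mem_map]
      refine .inr ⟨k, ⟨?_, ?_⟩, k :: t, ht, rfl⟩
      · cases k <;> simp
      · simpa [edge_iff] using h.1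

/-- The assignment with the given values. -/
def assign (b₁ b₂ b₃ b₄ b₅ : Bool) : MNode → Bool
  | c1 => b₁
  | c2 => b₂
  | c3 => b₃
  | a => b₄
  | y => b₅

theorem assign_eq (x : MNode → Bool) : assign (x c1) (x c2) (x c3) (x a) (x y) = x := by
  funext i
  cases i <;> rfl

theorem sum_assign {α : Type*} [AddCommMonoid α] (F : (MNode → Bool) → α) :
    ∑ x, F x = ∑ b₁, ∑ b₂, ∑ b₃, ∑ b₄, ∑ b₅, F (assign b₁ b₂ b₃ b₄ b₅) := by
  let e : Bool × Bool × Bool × Bool × Bool ≃ (MNode → Bool) :=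
    { toFun := fun b => assign b.1 b.2.1 b.2.2.1 b.2.2.2.1 b.2.2.2.2
      invFun := fun x => (x c1, x c2, x c3, x a, x y)
      left_inv := fun _ => rfl
      right_inv := assign_eq }
  rw [← e.sum_comp]
  simp only [Fintype.sum_prod_type]
  rfl

/-- Three times the conditional probability that the variable at `i` is true, given the values `x` of
the other variables. -/
def level (x : MNode → Bool) : MNode → ℕ
  | c1 => 1
  | c2 => 1
  | c3 => cond (x c1 && x c2) 2 1
  | a => cond (x c1) 2 1
  | y => cond (x a && x c2) 2 1

theorem level_pos (x : MNode → Bool) (i : MNode) : 0 < level x i := by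
  cases i <;> simp only [level, Bool.cond_eq_ite] <;> first | omega | (split_ifs <;> omega)

theorem level_lt (x : MNode → Bool) (i : MNode) : level x i < 3 := by
  cases i <;> simp only [level, Bool.cond_eq_ite] <;> first | omega | (split_ifs <;> omega)

/-- `3 ^ 5` times the probability of the joint value `x`. -/
def weight (x : MNode → Bool) : ℕ :=
  let g i := cond (x i) (level x i) (3 - level x i)
  g c1 * g c2 * g c3 * g a * g y

/-- `3 ^ 5` times the probability that all variables in `r` are true. -/
def weightTrue (r : MNode → Bool) : ℕ :=
  ∑ b₁, ∑ b₂, ∑ b₃, ∑ b₄, ∑ b₅,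
    cond ((!r c1 || b₁) && (!r c2 || b₂) && (!r c3 || b₃) && (!r a || b₄) && (!r y || b₅))
      (weight (assign b₁ b₂ b₃ b₄ b₅)) 0

instance : DecidableRel mBias.Adj := inferInstanceAs (DecidableRel Edge)

theorem weightTrue_mul_ne :
    ∀ i : MNode, ∀ p ∈ walks 4 i, p.Nodup → ∀ j ∈ p.getLast?, i ≠ j →
      ∀ b₁ b₂ b₃ b₄ b₅, (∀ m ∈ p, assign b₁ b₂ b₃ b₄ b₅ m = true ↔ m ∈ mBias.colliders p) →
        let r := assign b₁ b₂ b₃ b₄ b₅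
        weightTrue (fun k => k == i || (k == j || r k)) * weightTrue r ≠
          weightTrue (fun k => k == i || r k) * weightTrue (fun k => k == j || r k) := by
  -- The assignment `r` is fixed on the path by its colliders but free off it, so the check covers
  -- every conditioning set leaving the path open.
  decide +kernel

/-- The structural equations: the variable at `i` is true if the error, which is uniform on
`{0, 1, 2}`, is less than the level of `i`. -/
def response : ∀ i, ({j // mBias.Adj j i} → Bool) → Fin 3 → Bool
  | c1, _, e => decide (e.val < 1)
  | c2, _, e => decide (e.val < 1)
  | c3, x, e => decide (e.val < cond (x ⟨c1, .c1_c3⟩ && x ⟨c2, .c2_c3⟩) 2 1)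
  | a, x, e => decide (e.val < cond (x ⟨c1, .c1_a⟩) 2 1)
  | y, x, e => decide (e.val < cond (x ⟨a, .a_y⟩ && x ⟨c2, .c2_y⟩) 2 1)

theorem response_eq (x : MNode → Bool) (i : MNode) (e : Fin 3) :
    response i (fun j => x j) e = decide (e.val < level x i) := by
  cases i <;> rfl

/-- A causal model on the M-bias diagram with binary variables. -/
noncomputable def model : CausalModel.{0, 0, 0, 0} mBias (fun _ => Bool) where
  Ω := MNode → Fin 3
  P := Measure.pi fun _ => (PMF.uniformOfFintype (Fin 3)).toMeasure
  Noise _ := Fin 3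
  ε i ω := ω i
  measurable_ε i := measurable_pi_apply i
  indep_ε := iIndepFun_pi (X := fun _ e => e) fun _ => aemeasurable_id
  f := response
  measurable_f _ := Measurable.of_discrete

theorem uniform_lt {n : ℕ} (hn : n < 3) (b : Bool) :
    (PMF.uniformOfFintype (Fin 3)).toMeasure.real {e | decide (e.val < n) = b} =
      (cond b n (3 - n) : ℕ) / 3 := by
  have h : Fintype.card {e : Fin 3 | decide (e.val < n) = b} = cond b n (3 - n) := by
    interval_cases n <;> cases b <;> rfl
  rw [measureReal_def, PMF.toMeasure_uniformOfFintype_apply _ (Set.toFinite _).measurableSet, h]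
  simp

theorem measure_response_eq (x : MNode → Bool) :
    (Measure.pi fun _ => (PMF.uniformOfFintype (Fin 3)).toMeasure).real
      {ω : MNode → Fin 3 | ∀ i, response i (fun j => x j) (ω i) = x i} = weight x / 3 ^ 5 := by
  -- With the values fixed, the event is a product set in the independent errors.
  have h : {ω : MNode → Fin 3 | ∀ i, response i (fun j => x j) (ω i) = x i} =
      Set.univ.pi fun i => {e | decide (e.val < level x i) = x i} := by
    ext ω
    simp only [response_eq, Set.mem_univ_pi, Set.mem_ofPred_eq]
  rw [h, measureReal_def, Measure.pi_pi, ENNReal.toReal_prod]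
  simp only [← measureReal_def, uniform_lt (level_lt x _)]
  have huniv : (Finset.univ : Finset MNode) = {c1, c2, c3, a, y} := rfl
  rw [huniv]
  simp only [Finset.prod_insert, Finset.mem_insert, Finset.mem_singleton, reduceCtorEq, or_self,
    not_false_eq_true, Finset.prod_singleton, weight]
  push_cast
  ring

theorem measure_obs_eq (x : MNode → Bool) :
    model.P.real {ω | ∀ i, model.obs i ω = x i} = weight x / 3 ^ 5 := by
  simp only [model.forall_obs_eq_iff]
  exact measure_response_eq x

theorem fullSupport_model : model.FullSupport := by
  intro x
  have hpos : ∀ i, 0 < cond (x i) (level x i) (3 - level x i) := by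
    intro i
    have h₀ := level_pos x i
    have h₃ := level_lt x i
    cases x i
    · exact Nat.sub_pos_of_lt h₃
    · exact h₀
  have h : 0 < model.P.real {ω | ∀ i, model.obs i ω = x i} := by
    rw [measure_obs_eq]
    have : 0 < weight x := by
      simp only [weight]
      have := hpos c1
      have := hpos c2
      have := hpos c3
      have := hpos a
      have := hpos y
      positivity
    positivity
  exact (ENNReal.toReal_pos_iff.mp h).1

theorem weightTrue_eq_sum {r : MNode → Bool} {p : (MNode → Bool) → Prop} [DecidablePred p]
    (hp : ∀ x, p x ↔ ∀ i, r i = true → x i = true) :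
    weightTrue r = ∑ x with p x, weight x := by
  have h : ∀ x, (if p x then weight x else 0) =
      cond ((!r c1 || x c1) && (!r c2 || x c2) && (!r c3 || x c3) && (!r a || x a) &&
        (!r y || x y)) (weight x) 0 := by
    intro x
    rw [Bool.cond_eq_ite]
    refine if_congr ((hp x).trans ?_) rfl rfl
    simp only [Bool.and_eq_true, Bool.or_eq_true, Bool.not_eq_true', ← Bool.not_eq_true,
      ← imp_iff_not_or]
    refine ⟨fun h => ⟨⟨⟨⟨h c1, h c2⟩, h c3⟩, h a⟩, h y⟩, ?_⟩
    rintro ⟨⟨⟨⟨h₁, h₂⟩, h₃⟩, h₄⟩, h₅⟩ i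
    cases i <;> assumption
  simp only [Finset.sum_filter, h, sum_assign]
  rfl

theorem probTrue_eq {F : Set MNode} {r : MNode → Bool} (hr : ∀ i, r i = true ↔ i ∈ F) :
    model.probTrue F = weightTrue r / 3 ^ 5 := by
  have hm : Measurable fun ω i => model.obs i ω := measurable_pi_lambda _ model.measurable_obs
  have h := sum_measureReal_preimage_singleton (μ := model.P)
    (Finset.univ.filter fun x : MNode → Bool => ∀ i, r i = true → x i = true)
    (f := fun ω i => model.obs i ω) fun x _ => hm (measurableSet_singleton x)
  have hF : (fun ω i => model.obs i ω) ⁻¹'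
      (Finset.univ.filter fun x : MNode → Bool => ∀ i, r i = true → x i = true) =
        {ω | ∀ i ∈ F, model.obs i ω = true} := by
    ext ω
    simp [hr]
  have hx : ∀ x : MNode → Bool, model.P.real ((fun ω i => model.obs i ω) ⁻¹' {x}) =
      weight x / 3 ^ 5 := by
    intro x
    rw [← measure_obs_eq]
    congr 1
    ext ω
    simp [funext_iff]
  rw [CausalModel.probTrue, ← hF, ← h]
  simp only [hx]
  rw [← Finset.sum_div, weightTrue_eq_sum fun _ => Iff.rfl, Nat.cast_sum]

theorem not_ancestor_of_sink {i j : MNode} (h : mBias.Ancestor i j) (hi : i = c3 ∨ i = y) : False := by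
  obtain ⟨k, hk, -⟩ := Relation.TransGen.head'_iff.mp h
  rcases hi with rfl | rfl <;> cases hk

theorem eq_of_isCollider {p : List MNode} (hp : p.Nodup) {m : MNode}
    (h : mBias.IsCollider p m) : m = c3 ∨ m = y := by
  obtain ⟨l, r, hlr, hl, hr⟩ := h
  have hne : l ≠ r := by
    have := hp.sublist hlr.sublist
    simp_all
  cases hl <;> cases hr <;> simp_all

theorem faithful_model : model.Faithful := by
  classical
  intro S T R hST hSR hTR hind i hi j hj p hp
  by_contra hb
  obtain ⟨hnd, hhd, hlast, hch⟩ := hp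
  obtain ⟨t, rfl⟩ : ∃ t, p = i :: t := by
    cases p with
    | nil => simp at hhd
    | cons k t => exact ⟨t, by simpa using hhd⟩
  have hij : i ≠ j := fun h => hST.le_bot ⟨hi, h ▸ hj⟩
  let r : MNode → Bool := fun k => decide (k ∈ R)
  have hlen : t.length ≤ 4 := by
    have h := hnd.length_le_card
    have hcard : Fintype.card MNode = 5 := rfl
    rw [List.length_cons, hcard] at h
    omega
  -- An unblocked path meets `R` exactly in its colliders: these can only be `c3` or `y`, which have
  -- no descendants and so must lie in `R` themselves.
  have hR : ∀ m ∈ i :: t, r m = true ↔ m ∈ mBias.colliders (i :: t) := by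
    intro m hm
    rw [← DAG.isCollider_iff_mem_colliders, decide_eq_true_iff]
    constructor
    · intro hmR
      by_contra hc
      exact hb (.inl ⟨m, hm, hmR, hc⟩)
    · intro hc
      by_contra hmR
      exact hb (.inr ⟨m, hc, hmR, fun d hd => (not_ancestor_of_sink hd (eq_of_isCollider hnd hc)).elim⟩)
  have key := weightTrue_mul_ne i _ (mem_walks hch hlen) hnd j hlast hij (r c1) (r c2) (r c3)
    (r a) (r y)
  rw [assign_eq] at key
  apply key hR
  have h := hind.probTrue_mul hi hj
  rw [probTrue_eq (r := fun k => k == i || (k == j || r k)) (by simp [r]),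
    probTrue_eq (r := r) (by simp [r]), probTrue_eq (r := fun k => k == i || r k) (by simp [r]),
    probTrue_eq (r := fun k => k == j || r k) (by simp [r]), div_mul_div_comm, div_mul_div_comm,
    div_left_inj' (by norm_num)] at h
  exact_mod_cast h

theorem isPreExposure_mBias : mBias.IsPreExposure a y {c1, c2, c3} where
  exposure_notMem := by simp
  outcome_notMem := by simp
  nondescendant := by
    intro C hC h
    have := rank_lt h
    rcases hC with rfl | rfl | rfl <;> simp [rank] at this
  ancestor_mem := by
    intro C h
    have := rank_lt h
    cases C <;> simp [rank] at this ⊢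

/-- With `X = ∅`, the forks `c3 ← c1 → a` and `c3 ← c2 → y` are open, the latter also given `a`. -/
theorem c3_mem_assocConfounders {M : CausalModel.{0, 0, w, w'} mBias (fun _ => Bool)}
    (hM : M.Faithful) : c3 ∈ M.assocConfounders {c1, c2, c3} a y := by
  refine ⟨by simp, ∅, Set.empty_subset _, fun h => ?_, fun h => ?_⟩
  · refine DAG.not_dSep_of_not_blocked (p := [c3, c1, a]) ⟨by decide, rfl, rfl, ?_⟩ ?_
      (hM _ _ _ (by simp) (by simp) (by simp) h)
    · exact .cons_cons (.inr .c1_c3) (.cons_cons (.inl .c1_a) (.singleton _))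
    · rintro (⟨m, -, hm, -⟩ | ⟨m, hm, -⟩)
      · exact hm
      · rw [DAG.isCollider_iff_mem_colliders] at hm
        exact List.not_mem_nil hm
  · refine DAG.not_dSep_of_not_blocked (p := [c3, c2, y]) ⟨by decide, rfl, rfl, ?_⟩ ?_
      (hM _ _ _ (by simp) (by simp) (by simp) h)
    · exact .cons_cons (.inr .c2_c3) (.cons_cons (.inl .c2_y) (.singleton _))
    · rintro (⟨m, hm, hmA, -⟩ | ⟨m, hm, -⟩)
      · simp_all
      · rw [DAG.isCollider_iff_mem_colliders] at hm
        exact List.not_mem_nil hm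

/-- Away from the collider `c3`, the errors split into that of `c1` and those of `c2` and `y`. -/
theorem noConfounding_of_c3_notMem {val : MNode → Type v} [∀ i, MeasurableSpace (val i)]
    (M : CausalModel.{0, v, w, w'} mBias val) {X : Set MNode} (hX : X ⊆ {c1, c2, c3})
    (h3 : c3 ∉ X) : M.NoConfounding a y X := by
  refine M.noConfounding_of_split (D := {c1}) (E := {c2, y}) (by simp) (by simp) (by simp) ?_ ?_
    (by simp) ?_ ?_ fun i hi => isPreExposure_mBias.nondescendant i (hX hi)
  · rintro i rfl j h
    cases h
  · rintro i (rfl | rfl) j h hj <;> cases h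
    · simp
    · exact absurd rfl hj
  · intro i hi
    rcases hX hi with rfl | rfl | rfl
    · simp
    · simp
    · exact absurd hi h3
  · rintro j ⟨⟩
    simp

end MNode

theorem proposition1 :
    (∀ {V : Type u} [Finite V] (G : DAG V) (val : V → Type v) [∀ i, MeasurableSpace (val i)]
      (M : CausalModel.{u, v, w, w'} G val) (A Y : V) (Pre : Set V),
      A ≠ Y → G.IsPreExposure A Y Pre → M.Faithful →
        M.NoConfounding A Y (M.assocConfounders Pre A Y)) ∧
    mBias.IsPreExposure MNode.a MNode.y {MNode.c1, MNode.c2, MNode.c3} ∧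
    (∃ M : CausalModel.{0, 0, 0, 0} mBias (fun _ => Bool),
      M.Faithful ∧ M.FullSupport ∧
      ¬ M.EachEliminatesBias {MNode.c1, MNode.c2, MNode.c3} MNode.a MNode.y
          (M.assocConfounders {MNode.c1, MNode.c2, MNode.c3} MNode.a MNode.y) ∧
      ¬ M.EachReducesBias {MNode.c1, MNode.c2, MNode.c3} MNode.a MNode.y
          (fun b => cond b 1 0) true false
          (M.assocConfounders {MNode.c1, MNode.c2, MNode.c3} MNode.a MNode.y)) := by
  refine ⟨fun G val _ M A Y Pre hAY hPre hM => hM.noConfounding_assocConfounders hAY hPre,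
    MNode.isPreExposure_mBias, MNode.model, MNode.faithful_model, MNode.fullSupport_model, ?_, ?_⟩
  · intro h
    obtain ⟨X, hX, h₁, h₀⟩ := h _ (MNode.c3_mem_assocConfounders MNode.faithful_model)
    by_cases h3 : MNode.c3 ∈ X
    · rw [Set.insert_eq_of_mem h3] at h₁
      exact h₀ h₁
    · exact h₀ (MNode.noConfounding_of_c3_notMem _ hX h3)
  · intro h
    obtain ⟨X, hX, hlt⟩ := h _ (MNode.c3_mem_assocConfounders MNode.faithful_model)
    by_cases h3 : MNode.c3 ∈ X
    · rw [Set.insert_eq_of_mem h3] at hlt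
      exact lt_irrefl _ hlt
    · have hA : MNode.a ∉ X := fun hA => MNode.isPreExposure_mBias.exposure_notMem (hX hA)
      -- The bias given `X` is already zero, so no absolute bias can be smaller.
      rw [(MNode.noConfounding_of_c3_notMem _ hX h3).adjustedContrast_eq MNode.fullSupport_model hA,
        sub_self, abs_zero] at hlt
      exact (abs_nonneg _).not_gt hlt
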